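/- All acting groups are countable and discrete. Let $G\curvearrowright_\alpha X$ and $H\curvearrowright_\beta Y$ be actions of countable discrete groups $G,H$ by continuous automorphisms on compact connected metrizable groups $X,Y$, with compatible metrics both denoted $d$. Assume that both actions are - topologically free: for every $g\neq e$ the set $\{x: gx\neq x\}$ is dense; - expansive: there is $\delta>0$ such that $x=y$ whenever $d(gx,gy)<\delta$ for all group elements $g$. A local conjugacy of $G\curvearrowright X$ is a homeomorphism $\gamma:U\to V$ between open subsets of $X$ such that $\lim_{g\to\infty}\sup_{z\in U}d(gz,g\gamma(z))=0$. (Here $\lim_{g\to\infty}\psi(g)=0$ means that for every $\varepsilon>0$ one has $|\psi(g)|<\varepsilon$ for all $g$ outside a finite subset of $G$.) Let $\mathcal R\subseteq X\times X$ be the local conjugacy relation, consisting of all $(x,\gamma(x))$ with $\gamma:U\to V$ a local conjugacy and $x\in U$, with the topology generated by the sets $\{(x,\gamma(x)):x\in U\}$. It is a topological (in fact étale) groupoid with product $(x,y)(y,z)=(x,z)$, and $G$ acts on it by automorphisms $g(x,y)=(gx,gy)$; this system is denoted $G\curvearrowright(X,\mathcal R)$. Let $H\curvearrowright(Y,\mathcal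 S)$ be the corresponding system for $\beta$. Let $\Delta_\alpha=\{x\in X:\lim_{g\to\infty}d(\alpha_g(x),\alpha_g(e))=0\}$ be the homoclinic group of $\alpha$. Then the following statements are equivalent: (i) $G\curvearrowright(X,\mathcal R)$ and $H\curvearrowright(Y,\mathcal S)$ are conjugate: there are an isomorphism of topological groupoids $\Phi:\mathcal R\to\mathcal S$ and a group isomorphism $\theta:G\to H$ with $\Phi(g\gamma)=\theta(g)\Phi(\gamma)$ for all $g\in G$, $\gamma\in\mathcal R$. (ii) $G\curvearrowright(X,\mathcal R)$ and $H\curvearrowright(Y,\mathcal S)$ are weakly continuously orbit equivalent: there are a homeomorphism $\varphi:X\to Y$ and continuous maps $a:\mathcal R\times G\to H$ and $b:\mathcal S\times H\to G$ such that $$((x,y),g)\mapsto\big(\varphi(x),\,a((x,y),g)\,\varphi(g^{-1}y)\big),\qquad ((u,v),h)\mapsto\big(\varphi^{-1}(u),\,b((u,v),h)\,\varphi^{-1}(h^{-1}v)\big)$$ are well-defined continuous maps $\mathcal R\times G\to\mathcal S$ and $\mathcal S\times H\to\mathcal R$, respectively, and such that $a((x,y),g)=a((x',y),g)$ for all $(x,y),(x',y)\in\mathcal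 R$, $g\in G$, and $b((u,v),h)=b((u',v),h)$ for all $(u,v),(u',v)\in\mathcal S$, $h\in H$. (iii) $G\curvearrowright X$ and $H\curvearrowright Y$ are continuously orbit equivalent: there are a homeomorphism $\varphi:X\to Y$ and continuous maps $a:G\times X\to H$ and $b:H\times Y\to G$ with $\varphi(gx)=a(g,x)\varphi(x)$ and $\varphi^{-1}(hy)=b(h,y)\varphi^{-1}(y)$ for all $g\in G$, $x\in X$, $h\in H$, $y\in Y$. (iv) $G\curvearrowright X$ and $H\curvearrowright Y$ are conjugate: there are a homeomorphism $\varphi:X\to Y$ and a group isomorphism $\theta:G\to H$ with $\varphi(gx)=\theta(g)\varphi(x)$ for all $g\in G$, $x\in X$. If moreover $\Delta_\alpha$ is dense in $X$, then (i)–(iv) are also equivalent to (v) $G\curvearrowright X$ and $H\curvearrowright Y$ are algebraically conjugate: there are a continuous group isomorphism $\varphi:X\to Y$ and a group isomorphism $\rho:G\to H$ with $\varphi(\alpha_g(x))=\beta_{\rho(g)}(\varphi(x))$ for all $g\in G$, $x\in X$. -/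

import Mathlib

open Filter Topology

namespace ExpansiveAction

section Systems

/-- The set of pairs `(x, y)` belonging to an equivalence relation. It is a structure of its own, so
that it carries no topology by default (in particular not the subspace topology of `X × X`). -/
@[ext]
structure RelGraph {X : Type*} (r : Setoid X) where
  fst : X
  snd : X
  rel : r fst snd

/-- A system `G ↷ (X, R)`: an equivalence relation `R` on a `G`-space `X`, a topology on (the graph
of) `R`, and the requirement that `g (x, y) = (g x, g y)` defines an action of `G` on `R` by
homeomorphisms (hence by automorphisms of the topological groupoid `R`). The relation is étale
if this topology makes `R` an étale groupoid. -/
structure AutSystem (G X : Type*) [Group G] [MulAction G X] where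
  rel : Setoid X
  top : TopologicalSpace (RelGraph rel)
  smul_rel : ∀ (g : G) {x y : X}, rel x y → rel (g • x) (g • y)
  continuous_smul : ∀ g : G, @Continuous _ _ top top
    (fun p : RelGraph rel => (⟨g • p.fst, g • p.snd, smul_rel g p.rel⟩ : RelGraph rel))

variable {G H X Y : Type*} [Group G] [Group H] [MulAction G X] [MulAction H Y]

/-- The groupoid underlying the relation of a system: elements `(x, y)` with range `x` and
domain `y`. -/
abbrev AutSystem.Gpd (R : AutSystem G X) : Type _ := RelGraph R.rel

instance (R : AutSystem G X) : TopologicalSpace R.Gpd := R.top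

/-- The product `(x, y)(y, z) = (x, z)` of composable elements. -/
def AutSystem.comp (R : AutSystem G X) (p q : R.Gpd) (h : p.snd = q.fst) : R.Gpd :=
  ⟨p.fst, q.snd, R.rel.trans p.rel (h ▸ q.rel)⟩

/-- The action `g (x, y) = (g x, g y)`. -/
def AutSystem.act (R : AutSystem G X) (g : G) (p : R.Gpd) : R.Gpd :=
  ⟨g • p.fst, g • p.snd, R.smul_rel g p.rel⟩

/-- Homomorphisms of topological groupoids between the relations of two systems. -/
def IsGpdHom (R : AutSystem G X) (S : AutSystem H Y) (Φ : R.Gpd → S.Gpd) : Prop :=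
  Continuous Φ ∧ ∀ (p q : R.Gpd) (h : p.snd = q.fst),
    ∃ h' : (Φ p).snd = (Φ q).fst, Φ (R.comp p q h) = S.comp (Φ p) (Φ q) h'

/-- Conjugacy of `G ↷ (X, R)` and `H ↷ (Y, S)`: an isomorphism of topological groupoids `R → S`
which is equivariant along a group isomorphism `G → H`. -/
def AutSystem.Conjugate (R : AutSystem G X) (S : AutSystem H Y) : Prop :=
  ∃ (Φ : R.Gpd ≃ₜ S.Gpd) (θ : G ≃* H), IsGpdHom R S Φ ∧ IsGpdHom S R Φ.symm ∧
    ∀ (g : G) (p : R.Gpd), Φ (R.act g p) = S.act (θ g) (Φ p)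

variable [TopologicalSpace G] [TopologicalSpace H] [TopologicalSpace X] [TopologicalSpace Y]

/-- The data of a continuous orbit equivalence between `G ↷ (X, R)` and `H ↷ (Y, S)`. -/
structure ContOrbitEquivData (R : AutSystem G X) (S : AutSystem H Y) where
  φ : X ≃ₜ Y
  a : R.Gpd × G → H
  b : S.Gpd × H → G
  continuous_a : Continuous a
  continuous_b : Continuous b
  mem_fwd : ∀ p : R.Gpd × G, S.rel (φ p.1.fst) (a p • φ (p.2⁻¹ • p.1.snd))
  mem_bwd : ∀ q : S.Gpd × H, R.rel (φ.symm q.1.fst) (b q • φ.symm (q.2⁻¹ • q.1.snd))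
  continuous_fwd : Continuous (fun p : R.Gpd × G =>
    (⟨φ p.1.fst, a p • φ (p.2⁻¹ • p.1.snd), mem_fwd p⟩ : S.Gpd))
  continuous_bwd : Continuous (fun q : S.Gpd × H =>
    (⟨φ.symm q.1.fst, b q • φ.symm (q.2⁻¹ • q.1.snd), mem_bwd q⟩ : R.Gpd))

/-- Weak continuous orbit equivalence of `G ↷ (X, R)` and `H ↷ (Y, S)`: there is a continuous orbit
equivalence for which `a (γ, g)` and `b (ν, h)` depend on `γ` and `ν` only through their domains. -/
def AutSystem.WeaklyContOrbitEquiv (R : AutSystem G X) (S : AutSystem H Y) : Prop :=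
  ∃ E : ContOrbitEquivData R S,
    (∀ (γ γ' : R.Gpd) (g : G), γ.snd = γ'.snd → E.a (γ, g) = E.a (γ', g)) ∧
    (∀ (ν ν' : S.Gpd) (h : H), ν.snd = ν'.snd → E.b (ν, h) = E.b (ν', h))

end Systems

section Actions

/-- `G ↷ X` is topologically free. -/
def TopologicallyFree (G X : Type*) [Group G] [TopologicalSpace X] [MulAction G X] : Prop :=
  ∀ g : G, g ≠ 1 → Dense {x : X | g • x ≠ x}

/-- `G ↷ X` is expansive. -/
def Expansive (G X : Type*) [Group G] [MetricSpace X] [MulAction G X] : Prop :=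
  ∃ δ : ℝ, 0 < δ ∧ ∀ x y : X, (∀ g : G, dist (g • x) (g • y) < δ) → x = y

/-- Conjugacy of the actions `G ↷ X` and `H ↷ Y`. -/
def ActionsConjugate (G X H Y : Type*) [Group G] [Group H] [TopologicalSpace X]
    [TopologicalSpace Y] [MulAction G X] [MulAction H Y] : Prop :=
  ∃ (φ : X ≃ₜ Y) (θ : G ≃* H), ∀ (g : G) (x : X), φ (g • x) = θ g • φ x

/-- Continuous orbit equivalence of the actions `G ↷ X` and `H ↷ Y`. -/
def ActionsContOrbitEquiv (G X H Y : Type*) [Group G] [Group H] [TopologicalSpace G]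
    [TopologicalSpace H] [TopologicalSpace X] [TopologicalSpace Y] [MulAction G X]
    [MulAction H Y] : Prop :=
  ∃ (φ : X ≃ₜ Y) (a : G × X → H) (b : H × Y → G), Continuous a ∧ Continuous b ∧
    (∀ (g : G) (x : X), φ (g • x) = a (g, x) • φ x) ∧
    (∀ (h : H) (y : Y), φ.symm (h • y) = b (h, y) • φ.symm y)

/-- Algebraic conjugacy of actions by automorphisms on the topological groups `X` and `Y`. -/
def AlgebraicallyConjugate (G X H Y : Type*) [Group G] [Group H] [Group X] [Group Y]
    [TopologicalSpace X] [TopologicalSpace Y] [MulAction G X] [MulAction H Y] : Prop :=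
  ∃ (φ : X ≃* Y) (ρ : G ≃* H), Continuous φ ∧ ∀ (g : G) (x : X), φ (g • x) = ρ g • φ x

/-- The homoclinic group `Δ` of an action by automorphisms: the points `x` with `d(g x, g e) → 0`
as `g → ∞`. -/
def homoclinicGroup (G X : Type*) [Group G] [Group X] [MetricSpace X] [IsTopologicalGroup X]
    [MulDistribMulAction G X] : Subgroup X where
  carrier := {x | Tendsto (fun g : G => dist (g • x) (g • (1 : X))) cofinite (𝓝 0)}
  one_mem' := by simpa using tendsto_const_nhds
  mul_mem' := by
    intro x y hx hy
    simp only [Set.mem_ofPred_eq, smul_one, smul_mul', ← tendsto_iff_dist_tendsto_zero] at *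
    simpa using hx.mul hy
  inv_mem' := by
    intro x hx
    simp only [Set.mem_ofPred_eq, smul_one, smul_inv', ← tendsto_iff_dist_tendsto_zero] at *
    simpa using hx.inv

end Actions

section LocalConjugacy

variable {G X : Type*} [Group G] [MetricSpace X] [MulAction G X]

variable (G) in
/-- A homeomorphism `γ : U → V` between open subsets of `X` is a local conjugacy if
`sup_{z ∈ U} d(g z, g γ(z)) → 0` as `g → ∞`. -/
def IsLocalConjugacy (γ : OpenPartialHomeomorph X X) : Prop :=
  ∀ ε : ℝ, 0 < ε → ∀ᶠ g : G in cofinite, ∀ z ∈ γ.source, dist (g • z) (g • γ z) < ε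

theorem IsLocalConjugacy.refl : IsLocalConjugacy G (OpenPartialHomeomorph.refl X) := by
  intro ε hε
  simp [hε]

theorem IsLocalConjugacy.symm {γ : OpenPartialHomeomorph X X} (h : IsLocalConjugacy G γ) :
    IsLocalConjugacy G γ.symm := by
  intro ε hε
  filter_upwards [h ε hε] with g hg z hz
  have := hg (γ.symm z) (γ.map_target hz)
  rwa [γ.right_inv hz, dist_comm] at this

theorem IsLocalConjugacy.trans {γ η : OpenPartialHomeomorph X X} (h : IsLocalConjugacy G γ)
    (h' : IsLocalConjugacy G η) : IsLocalConjugacy G (γ.trans η) := by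
  intro ε hε
  filter_upwards [h (ε / 2) (half_pos hε), h' (ε / 2) (half_pos hε)] with g hg hg' z hz
  rw [OpenPartialHomeomorph.trans_source] at hz
  have h1 := hg z hz.1
  have h2 := hg' (γ z) hz.2
  have h3 := dist_triangle (g • z) (g • γ z) (g • η (γ z))
  simp only [OpenPartialHomeomorph.coe_trans, Function.comp_apply]
  linarith

variable (G) in
/-- `x` and `y` are locally conjugate if some local conjugacy maps `x` to `y`. -/
def localConjugacySetoid (X : Type*) [MetricSpace X] [MulAction G X] : Setoid X where
  r x y := ∃ γ : OpenPartialHomeomorph X X, IsLocalConjugacy G γ ∧ x ∈ γ.source ∧ γ x = y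
  iseqv :=
    { refl := fun x => ⟨_, IsLocalConjugacy.refl, by simp, by simp⟩
      symm := by
        rintro x y ⟨γ, h, hx, rfl⟩
        exact ⟨γ.symm, h.symm, γ.map_source hx, γ.left_inv hx⟩
      trans := by
        rintro x y z ⟨γ, h, hx, rfl⟩ ⟨η, h', hy, rfl⟩
        exact ⟨γ.trans η, h.trans h', by simp [hx, hy], by simp⟩ }

variable (G) in
/-- The topology on the local conjugacy relation generated by the sets `{(x, γ(x)) : x ∈ U}`, where
`γ : U → V` runs through the local conjugacies. -/
@[reducible]
def localConjugacyTopology (X : Type*) [MetricSpace X] [MulAction G X] :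
    TopologicalSpace (RelGraph (localConjugacySetoid G X)) :=
  TopologicalSpace.generateFrom
    {B | ∃ γ : OpenPartialHomeomorph X X, IsLocalConjugacy G γ ∧
      B = {p | p.fst ∈ γ.source ∧ γ p.fst = p.snd}}

section Conj

variable [ContinuousConstSMul G X]

/-- The homeomorphism `g γ g⁻¹ : g U → g V`. -/
noncomputable def conjugateBy (g : G) (γ : OpenPartialHomeomorph X X) :
    OpenPartialHomeomorph X X :=
  ((Homeomorph.smul g⁻¹).toOpenPartialHomeomorph.trans γ).trans
    (Homeomorph.smul g).toOpenPartialHomeomorph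

@[simp]
theorem mem_conjugateBy_source (g : G) (γ : OpenPartialHomeomorph X X) (x : X) :
    x ∈ (conjugateBy g γ).source ↔ g⁻¹ • x ∈ γ.source := by
  simp [conjugateBy]

@[simp]
theorem conjugateBy_apply (g : G) (γ : OpenPartialHomeomorph X X) (x : X) :
    conjugateBy g γ x = g • γ (g⁻¹ • x) := by
  simp [conjugateBy]

theorem IsLocalConjugacy.conjugateBy {γ : OpenPartialHomeomorph X X} (h : IsLocalConjugacy G γ)
    (g : G) : IsLocalConjugacy G (conjugateBy g γ) := by
  intro ε hε
  have ht : Tendsto (fun k : G => k * g) cofinite cofinite :=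
    (mul_left_injective g).tendsto_cofinite
  filter_upwards [ht.eventually (h ε hε)] with k hk z hz
  have := hk (g⁻¹ • z) (by simpa using hz)
  simpa [mul_smul] using this

variable (G X) in
/-- The system `G ↷ (X, R)` on the local conjugacy relation `R` of an action `G ↷ X`. -/
def localConjugacySystem : AutSystem G X where
  rel := localConjugacySetoid G X
  top := localConjugacyTopology G X
  smul_rel := by
    rintro g x y ⟨γ, h, hx, rfl⟩
    exact ⟨conjugateBy g γ, h.conjugateBy g, by simpa using hx, by simp⟩
  continuous_smul := by
    intro g
    let _ := localConjugacyTopology G X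
    refine continuous_generateFrom_iff.2 ?_
    rintro _ ⟨γ, h, rfl⟩
    refine TopologicalSpace.isOpen_generateFrom_of_mem
      ⟨ExpansiveAction.conjugateBy g⁻¹ γ, h.conjugateBy g⁻¹, ?_⟩
    ext p
    simp [inv_smul_eq_iff]

end Conj

end LocalConjugacy

end ExpansiveAction

/-!
The point is that an expansive action by automorphisms of a compact connected group leaves very
little room for local conjugacies. By expansiveness, two local conjugacies which agree at a point
agree near it (`IsLocalConjugacy.eventually_eq`). Left translation by a homoclinic point is a local conjugacy, and
conversely locally conjugate points differ by a homoclinic factor. Hence a map `ψ : X → X` whose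
graph is a continuous section of the local conjugacy groupoid satisfies that `ψ x * x⁻¹` is locally
constant and homoclinic; as `X` is connected, `ψ` is a translation by a homoclinic point
(`exists_homoclinic_eq_mul`).

A cocycle with values in a discrete group is constant in the (connected) space variable. For a
continuous orbit equivalence of the actions this gives conjugacy at once, since the actions are
faithful. For a weak continuous orbit equivalence of the systems it gives maps `θ : G → H` and
`τ : H → G`, and by the rigidity above `φ` intertwines `g` and `θ g` up to a homoclinic
translation (`IsAffineEquivariant`). As `G` fixes the identity of `X`, this translation is a
coboundary, and `x ↦ (φ 1)⁻¹ * φ x` is equivariant along `θ`; the maps `θ` and `τ` are mutually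
inverse because a homoclinic translation of `X` becomes a translation of `Y` under `φ`.

The same rigidity shows that a conjugacy `φ` with `φ 1 = 1` satisfies `φ (s * x) = φ s * φ x` for
homoclinic `s`; when the homoclinic points are dense, `φ` is a homomorphism.
-/

namespace ExpansiveAction

/-! ### Germs of local conjugacies -/

section Germs

variable {G H X Y : Type*} [Group G] [Group H] [MetricSpace X] [MetricSpace Y]
  [MulAction G X] [MulAction H Y]

theorem IsLocalConjugacy.restr {γ : OpenPartialHomeomorph X X} (h : IsLocalConjugacy G γ)
    (s : Set X) : IsLocalConjugacy G (γ.restr s) := by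
  intro ε hε
  filter_upwards [h ε hε] with g hg z hz
  exact hg z (by simpa using (γ.restr_source s ▸ hz).1)

/-- Under an expansive action, the germ of a local conjugacy at `x` is determined by its value
at `x`. -/
theorem IsLocalConjugacy.eventually_eq [ContinuousConstSMul G X] (hexp : Expansive G X)
    {γ η : OpenPartialHomeomorph X X} (hγ : IsLocalConjugacy G γ) (hη : IsLocalConjugacy G η)
    {x : X} (hxγ : x ∈ γ.source) (hxη : x ∈ η.source) (hx : γ x = η x) :
    ∀ᶠ z in 𝓝 x, γ z = η z := by
  obtain ⟨δ, hδ, hexp⟩ := hexp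
  have hfin := (hγ (δ / 2) (half_pos hδ)).and (hη (δ / 2) (half_pos hδ))
  -- The finitely many `g` not controlled by the two limits are handled by continuity at `x`.
  have hnear : ∀ᶠ z in 𝓝 x, ∀ g ∈ {g : G | ¬((∀ z ∈ γ.source, dist (g • z) (g • γ z) < δ / 2) ∧
      ∀ z ∈ η.source, dist (g • z) (g • η z) < δ / 2)}, dist (g • γ z) (g • η z) < δ := by
    refine (Filter.eventually_all_finite hfin).2 fun g _ => ?_
    have hc : ContinuousAt (fun z => dist (g • γ z) (g • η z)) x :=
      ((γ.continuousAt hxγ).const_smul g).dist ((η.continuousAt hxη).const_smul g)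
    exact hc.eventually_lt_const (by simpa [hx] using hδ)
  filter_upwards [hnear, γ.open_source.mem_nhds hxγ, η.open_source.mem_nhds hxη] with z hz hzγ hzη
  refine hexp _ _ fun g => ?_
  by_cases hg : (∀ z ∈ γ.source, dist (g • z) (g • γ z) < δ / 2) ∧
      ∀ z ∈ η.source, dist (g • z) (g • η z) < δ / 2
  · have := dist_triangle_left (g • γ z) (g • η z) (g • z)
    linarith [hg.1 z hzγ, hg.2 z hzη]
  · exact hz g hg

/-- The open bisection of the local conjugacy groupoid given by an everywhere defined local
conjugacy is a continuous section. -/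
theorem continuous_section [ContinuousConstSMul G X] (hexp : Expansive G X) (e : X ≃ₜ X)
    (he : IsLocalConjugacy G e.toOpenPartialHomeomorph) :
    Continuous fun x => (⟨x, e x, ⟨_, he, by simp, by simp⟩⟩ : (localConjugacySystem G X).Gpd) := by
  refine continuous_generateFrom_iff.2 ?_
  rintro _ ⟨γ, hγ, rfl⟩
  refine isOpen_iff_mem_nhds.2 fun x hx => ?_
  obtain ⟨hx1, hx2⟩ : x ∈ γ.source ∧ γ x = e x := hx
  filter_upwards [γ.open_source.mem_nhds hx1,
    hγ.eventually_eq hexp he hx1 (by simp) (by simpa using hx2)] with z hz1 hz2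
  exact ⟨hz1, by simpa using hz2⟩

theorem continuous_fst [ContinuousConstSMul G X] :
    Continuous fun p : (localConjugacySystem G X).Gpd => p.fst := by
  refine continuous_def.2 fun W hW => isOpen_iff_mem_nhds.2 fun p hp => ?_
  obtain ⟨γ, hγ, hx, hy⟩ := p.rel
  have hopen : IsOpen[(localConjugacySystem G X).top]
      {q | q.fst ∈ (γ.restr W).source ∧ γ.restr W q.fst = q.snd} :=
    TopologicalSpace.isOpen_generateFrom_of_mem ⟨γ.restr W, hγ.restr W, rfl⟩
  refine Filter.mem_of_superset (hopen.mem_nhds ⟨?_, by simpa using hy⟩) fun q hq => ?_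
  · rw [γ.restr_source, hW.interior_eq]
    exact ⟨hx, hp⟩
  · have := hq.1
    rw [γ.restr_source, hW.interior_eq] at this
    exact this.2

/-- The target map of a continuous section is locally given by local conjugacies. -/
theorem exists_isLocalConjugacy_eventually_eq [ContinuousConstSMul G X]
    {F : X → (localConjugacySystem G X).Gpd} (hF : Continuous F) (hfst : ∀ x, (F x).fst = x)
    (x : X) : ∃ γ : OpenPartialHomeomorph X X, IsLocalConjugacy G γ ∧ x ∈ γ.source ∧
      ∀ᶠ z in 𝓝 x, (F z).snd = γ z := by
  obtain ⟨γ, hγ, hx, hy⟩ := (F x).rel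
  have hopen : IsOpen[(localConjugacySystem G X).top] {p | p.fst ∈ γ.source ∧ γ p.fst = p.snd} :=
    TopologicalSpace.isOpen_generateFrom_of_mem ⟨γ, hγ, rfl⟩
  rw [hfst] at hx
  refine ⟨γ, hγ, hx, ?_⟩
  filter_upwards [hF.continuousAt.preimage_mem_nhds (hopen.mem_nhds ⟨by rwa [hfst], hy⟩)] with z hz
  have := hz.2
  rw [hfst] at this
  exact this.symm

end Germs

/-! ### Rigidity of continuous sections -/

section Rigidity

variable {G X : Type*} [Group G] [Group X] [MetricSpace X] [IsTopologicalGroup X]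
  [MulDistribMulAction G X]

theorem mem_homoclinicGroup {x : X} :
    x ∈ homoclinicGroup G X ↔ Tendsto (fun g : G => g • x) cofinite (𝓝 1) := by
  rw [tendsto_iff_dist_tendsto_zero]
  change Tendsto (fun g : G => dist (g • x) (g • (1 : X))) cofinite (𝓝 0) ↔ _
  simp only [smul_one]

variable [CompactSpace X]

theorem isLocalConjugacy_mulLeft {s : X} (hs : s ∈ homoclinicGroup G X) :
    IsLocalConjugacy G (Homeomorph.mulLeft s).toOpenPartialHomeomorph := by
  intro ε hε
  have hunif : ∀ᶠ t in 𝓝 (1 : X), ∀ z ∈ (Set.univ : Set X), dist z (t * z) < ε := by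
    refine isCompact_univ.eventually_forall_of_forall_eventually fun z _ => ?_
    have hc : Continuous fun p : X × X => dist p.2 (p.1 * p.2) := by fun_prop
    exact hc.continuousAt.eventually_lt_const (by simpa using hε)
  filter_upwards [(mem_homoclinicGroup.1 hs).eventually hunif] with g hg z _
  simpa using hg (g • z) trivial

theorem mul_inv_mem_homoclinicGroup {x y : X} (h : localConjugacySetoid G X x y) :
    y * x⁻¹ ∈ homoclinicGroup G X := by
  obtain ⟨γ, hγ, hx, rfl⟩ := h
  have hc : UniformContinuous fun p : X × X => p.1 * p.2⁻¹ :=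
    CompactSpace.uniformContinuous_of_continuous (by fun_prop)
  rw [mem_homoclinicGroup, Metric.tendsto_nhds]
  intro ε hε
  obtain ⟨δ, hδ, hc⟩ := Metric.uniformContinuous_iff.1 hc ε hε
  filter_upwards [hγ δ hδ] with g hg
  have := @hc (g • γ x, g • x) (g • x, g • x) (by
    rw [Prod.dist_eq, dist_self]
    exact max_lt (by simpa [dist_comm] using hg x hx) hδ)
  simpa using this

variable [ConnectedSpace X] [ContinuousConstSMul G X]

/-- A continuous section of the local conjugacy groupoid of an expansive action on a connected group
is translation by a homoclinic point. -/
theorem exists_homoclinic_eq_mul (hexp : Expansive G X) {F : X → (localConjugacySystem G X).Gpd}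
    (hF : Continuous F) (hfst : ∀ x, (F x).fst = x) :
    ∃ t ∈ homoclinicGroup G X, ∀ x, (F x).snd = t * x := by
  have hmem : ∀ x, (F x).snd * x⁻¹ ∈ homoclinicGroup G X := fun x => by
    have := mul_inv_mem_homoclinicGroup (F x).rel
    rwa [hfst] at this
  have hloc : IsLocallyConstant fun x => (F x).snd * x⁻¹ := by
    refine (IsLocallyConstant.iff_eventually_eq _).2 fun x => ?_
    obtain ⟨γ, hγ, hx, hev⟩ := exists_isLocalConjugacy_eventually_eq hF hfst x
    have ht := isLocalConjugacy_mulLeft (hmem x)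
    filter_upwards [hev, hγ.eventually_eq hexp ht hx (by simp) (by simp [← hev.self_of_nhds])]
      with z hz hz'
    rw [hz, hz']
    simp
  obtain ⟨t, ht⟩ := hloc.exists_eq_const
  have ht' : ∀ x, (F x).snd * x⁻¹ = t := fun x => congrFun ht x
  exact ⟨t, ht' 1 ▸ hmem 1, fun x => by rw [← ht' x, inv_mul_cancel_right]⟩

end Rigidity

/-! ### Transport along a conjugacy of actions -/

section Transport

variable {G H X Y : Type*} [Group G] [Group H] [MetricSpace X] [MetricSpace Y]
  [MulAction G X] [MulAction H Y]

theorem IsLocalConjugacy.conj [CompactSpace X] {γ : OpenPartialHomeomorph X X}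
    (hγ : IsLocalConjugacy G γ) (φ : X ≃ₜ Y) (θ : G ≃* H)
    (hφ : ∀ (g : G) (x : X), φ (g • x) = θ g • φ x) :
    IsLocalConjugacy H
      ((φ.symm.toOpenPartialHomeomorph.trans γ).trans φ.toOpenPartialHomeomorph) := by
  intro ε hε
  obtain ⟨δ, hδ, hc⟩ := Metric.uniformContinuous_iff.1
    (CompactSpace.uniformContinuous_of_continuous φ.continuous) ε hε
  filter_upwards [θ.symm.injective.tendsto_cofinite.eventually (hγ δ hδ)] with h hh z hz
  have := hc (hh (φ.symm z) (by simpa using hz))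
  simpa [hφ] using this

theorem localConjugacySetoid_map [CompactSpace X] (φ : X ≃ₜ Y) (θ : G ≃* H)
    (hφ : ∀ (g : G) (x : X), φ (g • x) = θ g • φ x) {x y : X}
    (h : localConjugacySetoid G X x y) : localConjugacySetoid H Y (φ x) (φ y) := by
  obtain ⟨γ, hγ, hx, rfl⟩ := h
  exact ⟨_, hγ.conj φ θ hφ, by simpa using hx, by simp⟩

theorem equivariant_symm {φ : X ≃ₜ Y} {θ : G ≃* H}
    (hφ : ∀ (g : G) (x : X), φ (g • x) = θ g • φ x) (h : H) (y : Y) :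
    φ.symm (h • y) = θ.symm h • φ.symm y := by
  rw [Homeomorph.symm_apply_eq, hφ]
  simp

variable [ContinuousConstSMul G X] [ContinuousConstSMul H Y]

/-- The map `(x, y) ↦ (φ x, φ y)` of local conjugacy groupoids induced by a conjugacy of actions. -/
def gpdMap [CompactSpace X] (φ : X ≃ₜ Y) (θ : G ≃* H)
    (hφ : ∀ (g : G) (x : X), φ (g • x) = θ g • φ x) (p : (localConjugacySystem G X).Gpd) :
    (localConjugacySystem H Y).Gpd :=
  ⟨φ p.fst, φ p.snd, localConjugacySetoid_map φ θ hφ p.rel⟩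

theorem continuous_gpdMap [CompactSpace X] [CompactSpace Y] (φ : X ≃ₜ Y) (θ : G ≃* H)
    (hφ : ∀ (g : G) (x : X), φ (g • x) = θ g • φ x) : Continuous (gpdMap φ θ hφ) := by
  refine continuous_generateFrom_iff.2 ?_
  rintro _ ⟨γ, hγ, rfl⟩
  refine TopologicalSpace.isOpen_generateFrom_of_mem
    ⟨_, hγ.conj φ.symm θ.symm (equivariant_symm hφ), ?_⟩
  ext p
  let η := (φ.symm.symm.toOpenPartialHomeomorph.trans γ).trans φ.symm.toOpenPartialHomeomorph
  change φ p.fst ∈ γ.source ∧ γ (φ p.fst) = φ p.snd ↔ p.fst ∈ η.source ∧ η p.fst = p.snd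
  simp [η, Homeomorph.symm_apply_eq]

theorem isGpdHom_gpdMap [CompactSpace X] [CompactSpace Y] (φ : X ≃ₜ Y) (θ : G ≃* H)
    (hφ : ∀ (g : G) (x : X), φ (g • x) = θ g • φ x) :
    IsGpdHom (localConjugacySystem G X) (localConjugacySystem H Y) (gpdMap φ θ hφ) :=
  ⟨continuous_gpdMap φ θ hφ, fun _ _ h => ⟨congrArg φ h, rfl⟩⟩

theorem conjugate_of_actionsConjugate [CompactSpace X] [CompactSpace Y]
    (h : ActionsConjugate G X H Y) :
    (localConjugacySystem G X).Conjugate (localConjugacySystem H Y) := by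
  obtain ⟨φ, θ, hφ⟩ := h
  refine ⟨{ toFun := gpdMap φ θ hφ
            invFun := gpdMap φ.symm θ.symm (equivariant_symm hφ)
            left_inv := fun p => RelGraph.ext (by simp [gpdMap]) (by simp [gpdMap])
            right_inv := fun p => RelGraph.ext (by simp [gpdMap]) (by simp [gpdMap])
            continuous_toFun := continuous_gpdMap φ θ hφ
            continuous_invFun := continuous_gpdMap _ _ (equivariant_symm hφ) },
    θ, isGpdHom_gpdMap φ θ hφ, isGpdHom_gpdMap _ _ (equivariant_symm hφ), fun g p => ?_⟩
  exact RelGraph.ext (hφ g p.fst) (hφ g p.snd)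

/-- The unit space of the local conjugacy groupoid is `X`, so a conjugacy of systems restricts to a
conjugacy of actions. -/
theorem actionsConjugate_of_conjugate (hGexp : Expansive G X) (hHexp : Expansive H Y)
    (h : (localConjugacySystem G X).Conjugate (localConjugacySystem H Y)) :
    ActionsConjugate G X H Y := by
  obtain ⟨Φ, θ, hΦ, hΨ, hact⟩ := h
  let R := localConjugacySystem G X
  let S := localConjugacySystem H Y
  let u : X → R.Gpd := fun x => ⟨x, x, R.rel.refl x⟩
  let v : Y → S.Gpd := fun y => ⟨y, y, S.rel.refl y⟩
  have hu : Continuous u := continuous_section hGexp (Homeomorph.refl X) IsLocalConjugacy.refl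
  have hv : Continuous v := continuous_section hHexp (Homeomorph.refl Y) IsLocalConjugacy.refl
  have hΦu : ∀ x, Φ (u x) = v (Φ (u x)).fst := fun x =>
    RelGraph.ext rfl (hΦ.2 (u x) (u x) rfl).1
  have hΨv : ∀ y, Φ.symm (v y) = u (Φ.symm (v y)).fst := fun y =>
    RelGraph.ext rfl (hΨ.2 (v y) (v y) rfl).1
  refine ⟨{ toFun := fun x => (Φ (u x)).fst
            invFun := fun y => (Φ.symm (v y)).fst
            left_inv := fun x => ?_
            right_inv := fun y => ?_
            continuous_toFun := continuous_fst.comp (Φ.continuous.comp hu)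
            continuous_invFun := continuous_fst.comp (Φ.symm.continuous.comp hv) },
    θ, fun g x => congrArg RelGraph.fst (hact g (u x))⟩
  · change (Φ.symm (v (Φ (u x)).fst)).fst = x
    rw [← hΦu, Homeomorph.symm_apply_apply]
  · change (Φ (u (Φ.symm (v y)).fst)).fst = y
    rw [← hΨv, Homeomorph.apply_symm_apply]

theorem weaklyContOrbitEquiv_of_actionsConjugate [CompactSpace X] [CompactSpace Y]
    [TopologicalSpace G] [DiscreteTopology G] [TopologicalSpace H] [DiscreteTopology H]
    (h : ActionsConjugate G X H Y) :
    (localConjugacySystem G X).WeaklyContOrbitEquiv (localConjugacySystem H Y) := by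
  obtain ⟨φ, θ, hφ⟩ := h
  have hψ := equivariant_symm hφ
  have hfwd : ∀ p : (localConjugacySystem G X).Gpd × G,
      θ p.2 • φ (p.2⁻¹ • p.1.snd) = φ p.1.snd := fun p => by rw [← hφ, smul_inv_smul]
  have hbwd : ∀ q : (localConjugacySystem H Y).Gpd × H,
      θ.symm q.2 • φ.symm (q.2⁻¹ • q.1.snd) = φ.symm q.1.snd := fun q => by
    rw [← hψ, smul_inv_smul]
  refine ⟨{ φ := φ
            a := fun p => θ p.2
            b := fun q => θ.symm q.2
            continuous_a := continuous_of_discreteTopology.comp continuous_snd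
            continuous_b := continuous_of_discreteTopology.comp continuous_snd
            mem_fwd := fun p => by
              rw [hfwd]
              exact localConjugacySetoid_map φ θ hφ p.1.rel
            mem_bwd := fun q => by
              rw [hbwd]
              exact localConjugacySetoid_map φ.symm θ.symm hψ q.1.rel
            continuous_fwd := ?_
            continuous_bwd := ?_ }, fun _ _ _ _ => rfl, fun _ _ _ _ => rfl⟩
  · convert (continuous_gpdMap φ θ hφ).comp _root_.continuous_fst using 2 with p
    exact RelGraph.ext rfl (hfwd p)
  · convert (continuous_gpdMap φ.symm θ.symm hψ).comp _root_.continuous_fst using 2 with q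
    exact RelGraph.ext rfl (hbwd q)

end Transport

/-! ### Continuous orbit equivalence of actions -/

section OrbitEquivalence

variable {G H X Y : Type*} [Group G] [Group H] [TopologicalSpace X] [TopologicalSpace Y]
  [MulAction G X] [MulAction H Y]

theorem TopologicallyFree.eq_one [Nonempty X] (hfree : TopologicallyFree G X) {g : G}
    (hg : ∀ x : X, g • x = x) : g = 1 := by
  by_contra hne
  obtain ⟨x, hx⟩ := (hfree g hne).nonempty
  exact hx (hg x)

theorem TopologicallyFree.eq_of_smul_eq [Nonempty X] (hfree : TopologicallyFree G X) {g k : G}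
    (h : ∀ x : X, g • x = k • x) : g = k := by
  refine inv_mul_eq_one.1 (hfree.eq_one fun x => ?_) |>.symm
  rw [mul_smul, h, inv_smul_smul]

theorem actionsContOrbitEquiv_of_actionsConjugate [TopologicalSpace G] [DiscreteTopology G]
    [TopologicalSpace H] [DiscreteTopology H] (h : ActionsConjugate G X H Y) :
    ActionsContOrbitEquiv G X H Y := by
  obtain ⟨φ, θ, hφ⟩ := h
  refine ⟨φ, fun p => θ p.1, fun q => θ.symm q.1,
    continuous_of_discreteTopology.comp _root_.continuous_fst,
    continuous_of_discreteTopology.comp _root_.continuous_fst, hφ, fun h y => ?_⟩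
  rw [Homeomorph.symm_apply_eq, hφ]
  simp

theorem actionsConjugate_of_equivariant [Nonempty Y] (hfree : TopologicallyFree H Y) (φ : X ≃ₜ Y)
    (θ : G → H) (τ : H → G) (hφ : ∀ (g : G) (x : X), φ (g • x) = θ g • φ x)
    (hτθ : ∀ g, τ (θ g) = g) (hθτ : ∀ h, θ (τ h) = h) : ActionsConjugate G X H Y := by
  refine ⟨φ, { toFun := θ, invFun := τ, left_inv := hτθ, right_inv := hθτ, map_mul' := ?_ }, hφ⟩
  refine fun g k => hfree.eq_of_smul_eq fun y => ?_
  obtain ⟨x, rfl⟩ := φ.surjective y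
  rw [mul_smul, ← hφ, ← hφ, ← hφ, mul_smul]

/-- On connected spaces the cocycles of a continuous orbit equivalence do not depend on the point,
and are therefore homomorphisms if the actions are faithful. -/
theorem actionsConjugate_of_actionsContOrbitEquiv [ConnectedSpace X] [ConnectedSpace Y]
    [TopologicalSpace G] [DiscreteTopology G] [TopologicalSpace H] [DiscreteTopology H]
    (hGfree : TopologicallyFree G X) (hHfree : TopologicallyFree H Y)
    (h : ActionsContOrbitEquiv G X H Y) : ActionsConjugate G X H Y := by
  obtain ⟨φ, a, b, ha, hb, hφ, hψ⟩ := h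
  obtain ⟨x₀⟩ := (inferInstance : Nonempty X)
  obtain ⟨y₀⟩ := (inferInstance : Nonempty Y)
  have ha' : ∀ g x, a (g, x) = a (g, x₀) := fun g x =>
    PreconnectedSpace.constant inferInstance (f := fun x => a (g, x)) (by fun_prop)
  have hb' : ∀ h y, b (h, y) = b (h, y₀) := fun h y =>
    PreconnectedSpace.constant inferInstance (f := fun y => b (h, y)) (by fun_prop)
  simp only [ha'] at hφ
  simp only [hb'] at hψ
  have : Nonempty X := ⟨x₀⟩
  have : Nonempty Y := ⟨y₀⟩
  refine actionsConjugate_of_equivariant hHfree φ _ (fun h => b (h, y₀)) hφ (fun g => ?_) fun h => ?_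
  · refine hGfree.eq_of_smul_eq fun x => ?_
    have := hψ (a (g, x₀)) (φ x)
    rwa [← hφ, φ.symm_apply_apply, φ.symm_apply_apply, eq_comm] at this
  · refine hHfree.eq_of_smul_eq fun y => ?_
    have := hφ (b (h, y₀)) (φ.symm y)
    rwa [← hψ, φ.apply_symm_apply, φ.apply_symm_apply, eq_comm] at this

end OrbitEquivalence

/-! ### Weak continuous orbit equivalence -/

section WeakOrbitEquivalence

variable {G H X Y : Type*} [Group G] [Group H]
  [Group X] [MetricSpace X] [IsTopologicalGroup X]
  [Group Y] [MetricSpace Y] [IsTopologicalGroup Y]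
  [MulDistribMulAction G X] [MulDistribMulAction H Y]

/-- `φ` intertwines every `g : G`, followed by any homoclinic translation of `X`, with `θ g`, up to
a homoclinic translation of `Y`. -/
def IsAffineEquivariant (φ : X ≃ₜ Y) (θ : G → H) : Prop :=
  ∀ (g : G), ∀ s ∈ homoclinicGroup G X, ∃ t ∈ homoclinicGroup H Y, ∀ x : X,
    θ g • φ (g⁻¹ • (s * x)) = t * φ x

theorem IsAffineEquivariant.equivariant {φ : X ≃ₜ Y} {θ : G → H} (h : IsAffineEquivariant φ θ)
    (g : G) (x : X) : (φ 1)⁻¹ * φ (g • x) = θ g • ((φ 1)⁻¹ * φ x) := by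
  obtain ⟨t, -, ht⟩ := h g 1 (one_mem _)
  have h1 := ht 1
  have hx := ht (g • x)
  simp only [one_mul, smul_one, inv_smul_smul] at h1 hx
  rw [smul_mul', smul_inv', hx, h1]
  group

theorem IsAffineEquivariant.map_one [Nonempty Y] (hfree : TopologicallyFree H Y) {φ : X ≃ₜ Y}
    {θ : G → H} (h : IsAffineEquivariant φ θ) : θ 1 = 1 := by
  refine hfree.eq_one fun y => ?_
  have := h.equivariant 1 (φ.symm (φ 1 * y))
  simpa using this.symm

theorem IsAffineEquivariant.exists_map_mul [Nonempty Y] (hfree : TopologicallyFree H Y)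
    {φ : X ≃ₜ Y} {θ : G → H} (h : IsAffineEquivariant φ θ) {s : X}
    (hs : s ∈ homoclinicGroup G X) : ∃ t : Y, ∀ x : X, φ (s * x) = t * φ x := by
  obtain ⟨t, -, ht⟩ := h 1 s hs
  exact ⟨t, by simpa [h.map_one hfree] using ht⟩

theorem IsAffineEquivariant.rightInverse [Nonempty X] [Nonempty Y] (hHfree : TopologicallyFree H Y)
    {φ : X ≃ₜ Y} {θ : G → H} {τ : H → G} (hθ : IsAffineEquivariant φ θ)
    (hτ : IsAffineEquivariant φ.symm τ) (h : H) : θ (τ h) = h := by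
  obtain ⟨s, hs, hs'⟩ := hτ h 1 (one_mem _)
  obtain ⟨t, ht⟩ := hθ.exists_map_mul hHfree (inv_mem hs)
  -- On `Y`, the element `h` acts as `θ (τ h)` followed by a translation, which is trivial because
  -- both automorphisms fix the identity.
  have hw : ∃ w : Y, ∀ y, h • y = w * θ (τ h) • y := by
    refine ⟨t * φ 1 * θ (τ h) • (φ 1)⁻¹, fun y => ?_⟩
    have h1 := hs' (h • y)
    have h2 := hθ.equivariant (τ h) (φ.symm y)
    rw [one_mul, inv_smul_smul] at h1
    rw [φ.apply_symm_apply, smul_mul'] at h2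
    have h3 := ht (τ h • φ.symm y)
    rw [h1, inv_mul_cancel_left, φ.apply_symm_apply, ← h1] at h3
    rw [h3, mul_assoc _ (θ (τ h) • (φ 1)⁻¹), ← h2]
    group
  obtain ⟨w, hw⟩ := hw
  have hw1 : w = 1 := by simpa using (hw 1).symm
  exact (hHfree.eq_of_smul_eq fun y => by rw [hw, hw1, one_mul]).symm

theorem actionsConjugate_of_isAffineEquivariant (hGfree : TopologicallyFree G X)
    (hHfree : TopologicallyFree H Y) {φ : X ≃ₜ Y} {θ : G → H} {τ : H → G}
    (hθ : IsAffineEquivariant φ θ) (hτ : IsAffineEquivariant φ.symm τ) :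
    ActionsConjugate G X H Y :=
  actionsConjugate_of_equivariant hHfree (φ.trans (Homeomorph.mulLeft (φ 1)⁻¹)) θ τ
    (fun g x => by simpa using hθ.equivariant g x)
    (hτ.rightInverse hGfree (φ := φ.symm) hθ) (hθ.rightInverse hHfree hτ)

variable [CompactSpace X] [ConnectedSpace X] [CompactSpace Y] [ConnectedSpace Y]
  [ContinuousConstSMul G X] [ContinuousConstSMul H Y]
  [TopologicalSpace G] [TopologicalSpace H] [DiscreteTopology H]

/-- The cocycle `a (γ, g)` depends on the domain of `γ` only, hence not at all, and is the value
of `θ` at `g`. Evaluating the orbit equivalence on the section `x ↦ (x, s * x)` gives a section over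
`Y`, which is a homoclinic translation. -/
theorem ContOrbitEquivData.exists_isAffineEquivariant (hGexp : Expansive G X)
    (hHexp : Expansive H Y)
    (E : ContOrbitEquivData (localConjugacySystem G X) (localConjugacySystem H Y))
    (hE : ∀ (γ γ' : (localConjugacySystem G X).Gpd) (g : G), γ.snd = γ'.snd →
      E.a (γ, g) = E.a (γ', g)) : ∃ θ : G → H, IsAffineEquivariant E.φ θ := by
  let u : X → (localConjugacySystem G X).Gpd := fun x =>
    ⟨x, x, (localConjugacySystem G X).rel.refl x⟩
  have hu : Continuous u := continuous_section hGexp (Homeomorph.refl X) IsLocalConjugacy.refl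
  have hconst : ∀ g x, E.a (u x, g) = E.a (u 1, g) := fun g x =>
    PreconnectedSpace.constant inferInstance (f := fun x => E.a (u x, g))
      (E.continuous_a.comp (hu.prodMk continuous_const))
  refine ⟨fun g => E.a (u 1, g), fun g s hs => ?_⟩
  have hsec := continuous_section hGexp (Homeomorph.mulLeft s) (isLocalConjugacy_mulLeft hs)
  obtain ⟨t, ht, h⟩ := exists_homoclinic_eq_mul hHexp
    (E.continuous_fwd.comp ((hsec.comp E.φ.symm.continuous).prodMk (continuous_const (y := g))))
    (fun y => by simp)
  refine ⟨t, ht, fun x => ?_⟩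
  have hx := h (E.φ x)
  simp only [Function.comp_apply, E.φ.symm_apply_apply, Homeomorph.coe_mulLeft] at hx
  change E.a (u 1, g) • _ = _
  rw [← hx, ← hconst g (s * x)]
  congr 1
  exact hE _ _ g rfl

theorem actionsConjugate_of_weaklyContOrbitEquiv [DiscreteTopology G]
    (hGfree : TopologicallyFree G X) (hHfree : TopologicallyFree H Y)
    (hGexp : Expansive G X) (hHexp : Expansive H Y)
    (h : (localConjugacySystem G X).WeaklyContOrbitEquiv (localConjugacySystem H Y)) :
    ActionsConjugate G X H Y := by
  obtain ⟨E, hEa, hEb⟩ := h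
  let E' : ContOrbitEquivData (localConjugacySystem H Y) (localConjugacySystem G X) :=
    { φ := E.φ.symm, a := E.b, b := E.a, continuous_a := E.continuous_b
      continuous_b := E.continuous_a, mem_fwd := E.mem_bwd, mem_bwd := E.mem_fwd
      continuous_fwd := E.continuous_bwd, continuous_bwd := E.continuous_fwd }
  obtain ⟨θ, hθ⟩ := E.exists_isAffineEquivariant hGexp hHexp hEa
  obtain ⟨τ, hτ⟩ := E'.exists_isAffineEquivariant hHexp hGexp hEb
  exact actionsConjugate_of_isAffineEquivariant hGfree hHfree hθ hτ

end WeakOrbitEquivalence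

/-! ### Algebraic conjugacy -/

section Algebraic

variable {G H X Y : Type*} [Group G] [Group H]
  [Group X] [MetricSpace X] [CompactSpace X] [Group Y] [MetricSpace Y]
  [MulDistribMulAction G X] [MulDistribMulAction H Y]

theorem actionsConjugate_of_algebraicallyConjugate (h : AlgebraicallyConjugate G X H Y) :
    ActionsConjugate G X H Y := by
  obtain ⟨φ, ρ, hc, hφ⟩ := h
  exact ⟨Continuous.homeoOfEquivCompactToT2 (f := φ.toEquiv) hc, ρ, hφ⟩

variable [IsTopologicalGroup X] [IsTopologicalGroup Y] [CompactSpace Y] [ConnectedSpace Y]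
  [ContinuousConstSMul G X] [ContinuousConstSMul H Y]

theorem map_mul_of_mem_homoclinicGroup (hGexp : Expansive G X) (hHexp : Expansive H Y) (φ : X ≃ₜ Y)
    (θ : G ≃* H) (hφ : ∀ (g : G) (x : X), φ (g • x) = θ g • φ x) (hφ1 : φ 1 = 1) {s : X}
    (hs : s ∈ homoclinicGroup G X) (x : X) : φ (s * x) = φ s * φ x := by
  have hsec := continuous_section hGexp (Homeomorph.mulLeft s) (isLocalConjugacy_mulLeft hs)
  obtain ⟨t, -, ht⟩ := exists_homoclinic_eq_mul hHexp
    ((continuous_gpdMap φ θ hφ).comp (hsec.comp φ.symm.continuous)) (fun y => by simp [gpdMap])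
  have ht' : ∀ x, φ (s * x) = t * φ x := fun x => by simpa [gpdMap] using ht (φ x)
  have h1 := ht' 1
  rw [mul_one, hφ1, mul_one] at h1
  rw [ht', h1]

theorem algebraicallyConjugate_of_actionsConjugate (hGexp : Expansive G X) (hHexp : Expansive H Y)
    (hdense : Dense (homoclinicGroup G X : Set X)) (h : ActionsConjugate G X H Y) :
    AlgebraicallyConjugate G X H Y := by
  obtain ⟨φ, θ, hφ⟩ := h
  -- The point `φ 1` is fixed by `H`, so that translating by its inverse preserves equivariance.
  have hfix : ∀ g, θ g • φ 1 = φ 1 := fun g => by rw [← hφ, smul_one]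
  let ψ : X ≃ₜ Y := φ.trans (Homeomorph.mulLeft (φ 1)⁻¹)
  have hψ : ∀ (g : G) (x : X), ψ (g • x) = θ g • ψ x := fun g x => by
    simp [ψ, hφ, smul_mul', smul_inv', hfix]
  have hmul : ∀ s x, ψ (s * x) = ψ s * ψ x := fun s x => by
    refine congrFun (Continuous.ext_on (f := fun s => ψ (s * x)) (g := fun s => ψ s * ψ x) hdense
      (by fun_prop) (by fun_prop) fun s hs => ?_) s
    exact map_mul_of_mem_homoclinicGroup hGexp hHexp ψ θ hψ (by simp [ψ]) hs x
  exact ⟨{ ψ.toEquiv with map_mul' := hmul }, θ, ψ.continuous, hψ⟩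

end Algebraic

end ExpansiveAction

theorem proposition6p5
    {G H X Y : Type*}
    [Group G] [Countable G] [TopologicalSpace G] [DiscreteTopology G]
    [Group H] [Countable H] [TopologicalSpace H] [DiscreteTopology H]
    [Group X] [MetricSpace X] [IsTopologicalGroup X] [CompactSpace X] [ConnectedSpace X]
    [Group Y] [MetricSpace Y] [IsTopologicalGroup Y] [CompactSpace Y] [ConnectedSpace Y]
    [MulDistribMulAction G X] [ContinuousConstSMul G X]
    [MulDistribMulAction H Y] [ContinuousConstSMul H Y]
    (hGfree : ExpansiveAction.TopologicallyFree G X)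
    (hHfree : ExpansiveAction.TopologicallyFree H Y)
    (hGexp : ExpansiveAction.Expansive G X)
    (hHexp : ExpansiveAction.Expansive H Y) :
    [ (ExpansiveAction.localConjugacySystem G X).Conjugate
        (ExpansiveAction.localConjugacySystem H Y),
      (ExpansiveAction.localConjugacySystem G X).WeaklyContOrbitEquiv
        (ExpansiveAction.localConjugacySystem H Y),
      ExpansiveAction.ActionsContOrbitEquiv G X H Y,
      ExpansiveAction.ActionsConjugate G X H Y ].TFAE ∧
    (Dense (ExpansiveAction.homoclinicGroup G X : Set X) →
      [ (ExpansiveAction.localConjugacySystem G X).Conjugate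
          (ExpansiveAction.localConjugacySystem H Y),
        (ExpansiveAction.localConjugacySystem G X).WeaklyContOrbitEquiv
          (ExpansiveAction.localConjugacySystem H Y),
        ExpansiveAction.ActionsContOrbitEquiv G X H Y,
        ExpansiveAction.ActionsConjugate G X H Y,
        ExpansiveAction.AlgebraicallyConjugate G X H Y ].TFAE) := by
  have h14 := ExpansiveAction.actionsConjugate_of_conjugate hGexp hHexp
  have h41 := ExpansiveAction.conjugate_of_actionsConjugate (G := G) (H := H) (X := X) (Y := Y)
  have h42 := ExpansiveAction.weaklyContOrbitEquiv_of_actionsConjugate (G := G) (H := H)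
    (X := X) (Y := Y)
  have h24 := ExpansiveAction.actionsConjugate_of_weaklyContOrbitEquiv hGfree hHfree hGexp hHexp
  have h34 := ExpansiveAction.actionsConjugate_of_actionsContOrbitEquiv hGfree hHfree
  have h43 := ExpansiveAction.actionsContOrbitEquiv_of_actionsConjugate (G := G) (H := H)
    (X := X) (Y := Y)
  refine ⟨?_, fun hdense => ?_⟩
  · tfae_have 1 ↔ 4 := ⟨h14, h41⟩
    tfae_have 2 ↔ 4 := ⟨h24, h42⟩
    tfae_have 3 ↔ 4 := ⟨h34, h43⟩
    tfae_finish
  · tfae_have 1 ↔ 4 := ⟨h14, h41⟩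
    tfae_have 2 ↔ 4 := ⟨h24, h42⟩
    tfae_have 3 ↔ 4 := ⟨h34, h43⟩
    tfae_have 5 ↔ 4 := ⟨ExpansiveAction.actionsConjugate_of_algebraicallyConjugate,
      ExpansiveAction.algebraicallyConjugate_of_actionsConjugate hGexp hHexp hdense⟩
    tfae_finish
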